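/- All graphs are simple and $d$ denotes the extended shortest-path metric on the vertex set. For a graph $G$ and $k,\ell\ge 0$, let $\mathrm{MC}_{k,\ell}(G)$ be the free abelian group on the tuples $(x_0,\dots,x_k)$ of vertices with $x_i\ne x_{i+1}$ for all $0\le i<k$ and $d(x_0,x_1)+\dots+d(x_{k-1},x_k)=\ell$. Let $\partial=\sum_{i=1}^{k-1}(-1)^i\partial_i:\mathrm{MC}_{k,\ell}(G)\to\mathrm{MC}_{k-1,\ell}(G)$, where $\partial_i(x_0,\dots,x_k)$ is $(x_0,\dots,x_{i-1},x_{i+1},\dots,x_k)$ if this tuple has length $\ell$, and $0$ otherwise. The magnitude homology of $G$ is $\mathrm{MH}_{k,\ell}(G)=H_k(\mathrm{MC}_{*,\ell}(G))$, and its main diagonal is the sequence of groups $\mathrm{MH}_{k,k}(G)$, $k\ge 0$. An outerplanar graph with components $H_1,\dots,H_t$ ($t\ge1$), each of them a copy of $K_2$ or of a cycle graph $C_n$ ($n\ge3$), is a graph $G=H_1\star\dots\star H_t$ obtained by successively gluing: for $2\le s\le t$, $H_1\star\dots\star H_s$ arises from $H_1\star\dots\star H_{s-1}$ by identifying a single vertex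 of $H_s$ with a vertex of $H_1\star\dots\star H_{s-1}$, or a single edge of $H_s$ with an outer-face edge of $H_1\star\dots\star H_{s-1}$ (that is, an edge contained in at most one of the component cycles among $H_1,\dots,H_{s-1}$). **Theorem.** Let $G$ be an outerplanar graph with vertex set $V$ and edge set $E$, each of whose components is a copy of $K_2$ or of an even cycle $C_n$ with $n\neq 4$. Then every group $\mathrm{MH}_{k,k}(G)$, $k\ge 0$, on the main diagonal of the magnitude homology of $G$ is torsion-free, and $$\operatorname{rank}\mathrm{MH}_{k,k}(G)=\begin{cases}|V| & k=0,\\ 2|E| & k>0.\end{cases}$$ -/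

import Mathlib

/-! ### Magnitude homology of a graph -/

namespace MagnitudeHomology

universe u

variable {V : Type u} (G : SimpleGraph V)

/-- The length `d(x₀,x₁) + ⋯ + d(x_{k-1},x_k)` of a tuple of vertices, where `d` is the extended
shortest path metric of `G`. -/
noncomputable def tupleLength {k : ℕ} (x : Fin (k + 1) → V) : ℕ∞ :=
  ∑ i : Fin k, G.edist (x i.castSucc) (x i.succ)

/-- `x = (x₀,…,x_k)` is a `k`-path of length `l`: consecutive vertices are distinct and the length
is the natural number `l` (so all consecutive distances are finite). -/
def IsPathOfLength {k : ℕ} (l : ℕ) (x : Fin (k + 1) → V) : Prop :=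
  (∀ i : Fin k, x i.castSucc ≠ x i.succ) ∧ tupleLength G x = (l : ℕ∞)

/-- The magnitude chain group `MC_{k,l}(G)`: the free abelian group on the `k`-paths of
length `l`. -/
abbrev MC (k l : ℕ) : Type u :=
  {x : Fin (k + 1) → V // IsPathOfLength G l x} →₀ ℤ

/-- The generator of `MC_{k,l}(G)` given by a tuple if this is a `k`-path of length `l`, and `0`
otherwise. -/
noncomputable def gen {k : ℕ} (l : ℕ) (x : Fin (k + 1) → V) : MC G k l :=
  open Classical in
  if h : IsPathOfLength G l x then Finsupp.single ⟨x, h⟩ 1 else 0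

/-- Remove the vertex `x_{i+1}` from the tuple `(x₀,…,x_{k+1})`; for `i : Fin k` these are exactly
the inner vertices `x₁,…,x_k`. -/
def eraseInner {k : ℕ} (x : Fin (k + 2) → V) (i : Fin k) : Fin (k + 1) → V :=
  fun m => x (i.castSucc.succ.succAbove m)

/-- The differential `∂ = ∑_{i=1}^{k} (-1)^i ∂_i : MC_{k+1,l}(G) → MC_{k,l}(G)`, where `∂_i` removes
the vertex `x_i` if this preserves the length and is zero otherwise (here `i` is shifted by one).
A tuple obtained from a path by removing an inner vertex without changing the length is a path
again, see `isPathOfLength_eraseInner`. -/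
noncomputable def boundary (k l : ℕ) : MC G (k + 1) l →ₗ[ℤ] MC G k l :=
  Finsupp.linearCombination ℤ fun x =>
    ∑ i : Fin k, (-1 : ℤ) ^ ((i : ℕ) + 1) • gen G l (eraseInner x.1 i)

/-- The `k`-cycles of `MC_{*,l}(G)`; in degree `0` the differential is zero. -/
noncomputable def cycles : (k l : ℕ) → Submodule ℤ (MC G k l)
  | 0, _ => ⊤
  | k + 1, l => LinearMap.ker (boundary G k l)

/-- The `k`-boundaries of `MC_{*,l}(G)`; they are cycles by `boundaries_le_cycles`. -/
noncomputable def boundaries (k l : ℕ) : Submodule ℤ (MC G k l) :=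
  LinearMap.range (boundary G k l)

/-- Magnitude homology `MH_{k,l}(G) = H_k(MC_{*,l}(G))`: cycles modulo boundaries. -/
abbrev MH (k l : ℕ) : Type u :=
  cycles G k l ⧸ (boundaries G k l).submoduleOf (cycles G k l)

/-! The differential squares to zero. -/

theorem tupleLength_eraseInner {k : ℕ} (x : Fin (k + 2) → V) (i : Fin k) :
    tupleLength G (eraseInner x i) +
        (G.edist (x i.castSucc.castSucc) (x i.castSucc.succ) +
          G.edist (x i.castSucc.succ) (x i.succ.succ)) =
      tupleLength G x + G.edist (x i.castSucc.castSucc) (x i.succ.succ) := by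
  obtain ⟨k, rfl⟩ : ∃ k', k = k' + 1 := ⟨k - 1, by have := i.2; omega⟩
  unfold tupleLength
  rw [Fin.sum_univ_succAbove _ i,
    Fin.sum_univ_succAbove (fun j => G.edist (x j.castSucc) (x j.succ)) i.succ,
    Fin.sum_univ_succAbove
      (fun j => G.edist (x (i.succ.succAbove j).castSucc) (x (i.succ.succAbove j).succ)) i]
  have h : ∀ m : Fin k, G.edist (eraseInner x i (i.succAbove m).castSucc)
        (eraseInner x i (i.succAbove m).succ) =
      G.edist (x (i.succ.succAbove (i.succAbove m)).castSucc)
        (x (i.succ.succAbove (i.succAbove m)).succ) := by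
    intro m
    unfold eraseInner
    congr 2 <;>
    · rcases i with ⟨i, _⟩
      rcases m with ⟨m, _⟩
      ext
      simp only [Fin.succAbove, Fin.lt_def, Fin.val_castSucc, Fin.val_succ]
      split_ifs <;> simp at * <;> omega
  have h1 : eraseInner x i i.castSucc = x i.castSucc.castSucc := by
    unfold eraseInner
    congr 1
    ext
    simp [Fin.succAbove]
  have h2 : eraseInner x i i.succ = x i.succ.succ := by
    unfold eraseInner
    congr 1
    ext
    simp [Fin.succAbove]
  simp only [h, h1, h2, Fin.succAbove_succ_self]
  simp only [Fin.succ_castSucc]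
  ac_rfl

theorem tupleLength_eraseInner_le {k : ℕ} (x : Fin (k + 2) → V) (i : Fin k) :
    tupleLength G (eraseInner x i) ≤ tupleLength G x := by
  have h := tupleLength_eraseInner G x i
  have ht := G.edist_triangle (u := x i.castSucc.castSucc) (v := x i.castSucc.succ)
    (w := x i.succ.succ)
  by_cases htop : G.edist (x i.castSucc.castSucc) (x i.succ.succ) = ⊤
  · have h3 : tupleLength G x = ⊤ := by
      rw [htop, top_le_iff, ENat.add_eq_top] at ht
      unfold tupleLength
      rw [← top_le_iff]
      rcases ht with ht | ht
      · rw [← ht]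
        exact Finset.single_le_sum (f := fun j : Fin (k + 1) => G.edist (x j.castSucc) (x j.succ))
          (fun _ _ => zero_le) (Finset.mem_univ i.castSucc)
      · rw [← ht, Fin.succ_castSucc]
        exact Finset.single_le_sum (f := fun j : Fin (k + 1) => G.edist (x j.castSucc) (x j.succ))
          (fun _ _ => zero_le) (Finset.mem_univ i.succ)
    simp [h3]
  · have : tupleLength G (eraseInner x i) + G.edist (x i.castSucc.castSucc) (x i.succ.succ) ≤
        tupleLength G x + G.edist (x i.castSucc.castSucc) (x i.succ.succ) := by
      rw [← h]; gcongr
    exact (ENat.add_le_add_iff_right htop).1 this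

/-- If removing an inner vertex from a path keeps the length, the result is again a path. -/
theorem isPathOfLength_eraseInner {k l : ℕ} (x : Fin (k + 2) → V) (hx : IsPathOfLength G l x)
    (i : Fin k) (hl : tupleLength G (eraseInner x i) = l) :
    IsPathOfLength G l (eraseInner x i) := by
  refine ⟨fun m heq => ?_, hl⟩
  by_cases hm : m = i
  · subst hm
    have h := tupleLength_eraseInner G x m
    have h1 : eraseInner x m m.castSucc = x m.castSucc.castSucc := by
      unfold eraseInner
      congr 1
      ext
      simp [Fin.succAbove]
    have h2 : eraseInner x m m.succ = x m.succ.succ := by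
      unfold eraseInner
      congr 1
      ext
      simp [Fin.succAbove]
    rw [h1, h2] at heq
    rw [heq, SimpleGraph.edist_self, hl, hx.2] at h
    have h3 := ENat.add_right_injective_of_ne_top (ENat.natCast_ne_top l) h
    have h4 := (add_eq_zero.1 h3).1
    rw [SimpleGraph.edist_eq_zero_iff] at h4
    exact hx.1 m.castSucc (by rw [heq]; exact h4)
  · have h := hx.1 (i.succ.succAbove m)
    apply h
    unfold eraseInner at heq
    convert heq using 2 <;>
    · rcases i with ⟨i, _⟩
      rcases m with ⟨m, _⟩
      clear h heq hl
      simp only [Fin.mk.injEq] at hm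
      simp only [Fin.succAbove, Fin.ext_iff, Fin.lt_def, Fin.val_castSucc, Fin.val_succ]
      split_ifs <;> simp at * <;> omega

theorem boundary_single {k l : ℕ} (x : Fin (k + 2) → V) (hx : IsPathOfLength G l x) :
    boundary G k l (Finsupp.single ⟨x, hx⟩ 1) =
      ∑ i : Fin k, (-1 : ℤ) ^ ((i : ℕ) + 1) • gen G l (eraseInner x i) := by
  simp [boundary]

theorem boundary_gen_eraseInner {k l : ℕ} (x : Fin (k + 3) → V) (hx : IsPathOfLength G l x)
    (i : Fin (k + 1)) :
    boundary G k l (gen G l (eraseInner x i)) =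
      ∑ j : Fin k, (-1 : ℤ) ^ ((j : ℕ) + 1) • gen G l (eraseInner (eraseInner x i) j) := by
  by_cases h : IsPathOfLength G l (eraseInner x i)
  · rw [← boundary_single G _ h, gen, dif_pos h]
  · rw [gen, dif_neg h, map_zero]
    symm
    refine Finset.sum_eq_zero fun j _ => ?_
    rw [gen, dif_neg, smul_zero]
    intro h'
    apply h
    apply isPathOfLength_eraseInner G x hx
    apply le_antisymm
    · exact hx.2 ▸ tupleLength_eraseInner_le G x i
    · exact h'.2 ▸ tupleLength_eraseInner_le G (eraseInner x i) j

theorem eraseInner_eraseInner {k : ℕ} (x : Fin (k + 3) → V) (j i : Fin k) (h : i ≤ j) :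
    eraseInner (eraseInner x j.succ) i = eraseInner (eraseInner x i.castSucc) j := by
  funext m
  unfold eraseInner
  congr 1
  rcases i with ⟨i, _⟩
  rcases j with ⟨j, _⟩
  rcases m with ⟨m, _⟩
  simp only [Fin.succAbove, Fin.ext_iff, Fin.lt_def, Fin.le_def, Fin.val_castSucc, Fin.val_succ] at *
  split_ifs <;> simp at * <;> omega

theorem boundary_comp_boundary (k l : ℕ) :
    boundary G k l ∘ₗ boundary G (k + 1) l = 0 := by
  refine Finsupp.lhom_ext' fun ⟨x, hx⟩ => LinearMap.ext_ring ?_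
  simp only [LinearMap.comp_apply, Finsupp.lsingle_apply, LinearMap.zero_apply]
  rw [boundary_single, map_sum]
  simp only [map_smul, boundary_gen_eraseInner G x hx, Finset.smul_sum, smul_smul]
  rw [← Finset.sum_product', Finset.univ_product_univ]
  refine Finset.sum_involution
    (fun p _ => if h : p.1 ≤ p.2.castSucc
      then (p.2.succ, p.1.castLT (lt_of_le_of_lt (Fin.le_def.1 h) p.2.2))
      else (p.2.castSucc, p.1.pred (fun h0 => h (h0 ▸ Fin.zero_le _)))) ?_ ?_ ?_ ?_
  · rintro ⟨i, j⟩ -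
    by_cases h : i ≤ j.castSucc
    · obtain ⟨i, rfl⟩ : ∃ i', i = Fin.castSucc i' :=
        ⟨i.castLT (lt_of_le_of_lt (Fin.le_def.1 h) j.2), by simp⟩
      simp only [dif_pos h, Fin.castLT_castSucc]
      rw [eraseInner_eraseInner x j i (by simpa using h), ← add_smul]
      simp only [Fin.val_castSucc, Fin.val_succ]
      convert zero_smul ℤ _ using 2
      ring
    · obtain ⟨i, rfl⟩ : ∃ i', i = Fin.succ i' :=
        ⟨i.pred (fun h0 => h (h0 ▸ Fin.zero_le _)), by simp⟩
      simp only [dif_neg h, Fin.pred_succ]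
      have hij : j ≤ i := by
        simp only [Fin.le_def, Fin.val_castSucc, Fin.val_succ] at h ⊢
        omega
      rw [eraseInner_eraseInner x i j hij, ← add_smul]
      simp only [Fin.val_castSucc, Fin.val_succ]
      convert zero_smul ℤ _ using 2
      ring
  · rintro ⟨i, j⟩ - - heq
    by_cases h : i ≤ j.castSucc
    · simp only [dif_pos h, Prod.mk.injEq] at heq
      have := heq.1
      simp only [Fin.le_def, Fin.ext_iff, Fin.val_castSucc, Fin.val_succ] at h this
      omega
    · simp only [dif_neg h, Prod.mk.injEq] at heq
      have := heq.1
      simp only [Fin.le_def, Fin.ext_iff, Fin.val_castSucc] at h this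
      omega
  · intro _ _
    exact Finset.mem_univ _
  · rintro ⟨i, j⟩ -
    by_cases h : i ≤ j.castSucc
    · have h' : ¬ j.succ ≤ (i.castLT (lt_of_le_of_lt (Fin.le_def.1 h) j.2)).castSucc := by
        simp only [Fin.le_def, Fin.val_castSucc, Fin.val_succ, Fin.castSucc_castLT] at h ⊢
        omega
      simp only [dif_pos h]
      rw [dif_neg h']
      simp only [Fin.pred_succ, Fin.castSucc_castLT]
    · have h' : j.castSucc ≤ (i.pred (fun h0 => h (h0 ▸ Fin.zero_le _))).castSucc := by
        simp only [Fin.le_def, Fin.val_castSucc, Fin.val_pred] at h ⊢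
        omega
      simp only [dif_neg h, dif_pos h', Fin.succ_pred, Fin.castLT_castSucc]

theorem boundaries_le_cycles (k l : ℕ) : boundaries G k l ≤ cycles G k l := by
  cases k with
  | zero => exact le_top
  | succ k =>
    rintro _ ⟨c, rfl⟩
    exact LinearMap.congr_fun (boundary_comp_boundary G k l) c

end MagnitudeHomology

/-! ### Outerplanar graphs as gluings of edges and cycles -/

namespace Outerplanar

universe u

variable {V : Type u} {G : SimpleGraph V}

/-- The subgraph `H` is a copy of `K₂`. -/
def IsK2 (H : G.Subgraph) : Prop :=
  Nonempty (H.coe ≃g (⊤ : SimpleGraph (Fin 2)))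

/-- The subgraph `H` is a copy of the cycle graph `C_n`. -/
def IsCycle (H : G.Subgraph) (n : ℕ) : Prop :=
  3 ≤ n ∧ Nonempty (H.coe ≃g SimpleGraph.cycleGraph n)

/-- The subgraph `H₁ ⋆ ⋯ ⋆ H_{s-1}` formed by the components before `H s`. -/
def before {t : ℕ} (H : Fin t → G.Subgraph) (s : Fin t) : G.Subgraph :=
  ⨆ r, ⨆ (_ : r < s), H r

/-- The edge `e` of `H₁ ⋆ ⋯ ⋆ H_{s-1}` lies on the outer face. The bounded faces of the drawing of
`H₁ ⋆ ⋯ ⋆ H_{s-1}` are exactly the insides of the component cycles glued so far, and an edge has at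
most two sides, so `e` borders the outer face if and only if it belongs to at most one of these
cycles. (All vertices are on the outer face.) -/
def IsOuterFaceEdge {t : ℕ} (H : Fin t → G.Subgraph) (s : Fin t) (e : Sym2 V) : Prop :=
  e ∈ (before H s).edgeSet ∧
    {r : Fin t | r < s ∧ (∃ n, IsCycle (H r) n) ∧ e ∈ (H r).edgeSet}.Subsingleton

/-- `G = H₁ ⋆ ⋯ ⋆ H_t` is an outerplanar graph with components `H₁, …, H_t`: each `H_s` is a copy
of `K₂` or of a cycle graph, `G` is the union of the `H_s`, and for `s > 1` the component `H_s`
is glued to `H₁ ⋆ ⋯ ⋆ H_{s-1}` along exactly one vertex or along exactly one edge (with its two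
endpoints), which is an outer-face edge of `H₁ ⋆ ⋯ ⋆ H_{s-1}`. Here `t = m + 1 ≥ 1`, and `H 0` is
the first component. -/
structure IsOuterplanarGluing {m : ℕ} (G : SimpleGraph V) (H : Fin (m + 1) → G.Subgraph) :
    Prop where
  component : ∀ s, IsK2 (H s) ∨ ∃ n, IsCycle (H s) n
  union : ⨆ s, H s = ⊤
  glue : ∀ s, s ≠ 0 →
    (∃ v, before H s ⊓ H s = G.singletonSubgraph v) ∨
    (∃ (u v : V) (h : G.Adj u v), before H s ⊓ H s = G.subgraphOfAdj h ∧
      IsOuterFaceEdge H s s(u, v))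

end Outerplanar

/-! The idea: a gluing of copies of `K₂` and of cycles of length at least five has no triangles and
no 4-cycles, since both short cycles would have to lie on one side of the clique (vertex or edge)
along which the pieces are glued (`noShortCycle_sup`). In such a graph, two vertices with a common
neighbour are equal or at distance two with a *unique* midpoint.

On the diagonal, the generators of `MC_{k,k}` are the walks of length `k`, and `MC_{k+1,k} = 0`, so
`MH_{k,k}` is just the group of cycles, a subgroup of a free abelian group. Deleting the inner
vertex `x_i` of a walk preserves the length exactly when `x_{i-1} ≠ x_{i+1}` (there are no
triangles). The resulting tuple remembers `i` as the position of its only step of length two, and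
remembers `x_i` as the unique midpoint of this step. Hence no cancellation can occur in `∂`, and its
kernel is spanned by the walks `(u,v,u,v,…)` (`ker_boundary_eq_supported`), one for each oriented
edge. -/

universe u

/-! ### Short cycles in gluings -/

namespace Outerplanar

variable {V : Type u} {G : SimpleGraph V}

/-- The subgraph `H` contains neither a triangle nor a cycle of length four; equivalently, its girth
is at least five. -/
def NoShortCycle (H : G.Subgraph) : Prop :=
  (∀ a b c, H.Adj a b → H.Adj b c → H.Adj c a → False) ∧
  ∀ a b c d, H.Adj a b → H.Adj b c → H.Adj c d → H.Adj d a → a ≠ c → b ≠ d → False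

/-- Gluing along a clique (common to both pieces) creates no short cycles. -/
theorem noShortCycle_sup {A B : G.Subgraph} (hA : NoShortCycle A) (hB : NoShortCycle B)
    (hAB : ∀ a b, a ∈ A.verts → a ∈ B.verts → b ∈ A.verts → b ∈ B.verts → a ≠ b →
      A.Adj a b ∧ B.Adj a b) :
    NoShortCycle (A ⊔ B) := by
  have ofA : ∀ {a b}, a ∈ A.verts → b ∈ A.verts → (A ⊔ B).Adj a b → A.Adj a b := by
    intro a b ha hb h
    rcases SimpleGraph.Subgraph.sup_adj.1 h with h | h
    · exact h
    · exact (hAB a b ha h.fst_mem hb h.snd_mem h.ne).1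
  have ofB : ∀ {a b}, a ∈ B.verts → b ∈ B.verts → (A ⊔ B).Adj a b → B.Adj a b := by
    intro a b ha hb h
    rcases SimpleGraph.Subgraph.sup_adj.1 h with h | h
    · exact (hAB a b h.fst_mem ha h.snd_mem hb h.ne).2
    · exact h
  have side : ∀ {a b}, (A ⊔ B).Adj a b →
      (a ∈ A.verts ∧ b ∈ A.verts) ∨ (a ∈ B.verts ∧ b ∈ B.verts) := by
    intro a b h
    rcases SimpleGraph.Subgraph.sup_adj.1 h with h | h
    · exact .inl ⟨h.fst_mem, h.snd_mem⟩
    · exact .inr ⟨h.fst_mem, h.snd_mem⟩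
  have tri : ∀ a b c, (A ⊔ B).Adj a b → (A ⊔ B).Adj b c → (A ⊔ B).Adj c a → False := by
    intro a b c hab hbc hca
    have : (a ∈ A.verts ∧ b ∈ A.verts ∧ c ∈ A.verts) ∨
        (a ∈ B.verts ∧ b ∈ B.verts ∧ c ∈ B.verts) := by
      have := side hab
      have := side hbc
      have := side hca
      tauto
    rcases this with ⟨ha, hb, hc⟩ | ⟨ha, hb, hc⟩
    · exact hA.1 a b c (ofA ha hb hab) (ofA hb hc hbc) (ofA hc ha hca)
    · exact hB.1 a b c (ofB ha hb hab) (ofB hb hc hbc) (ofB hc ha hca)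
  refine ⟨tri, fun a b c d hab hbc hcd hda hac hbd => ?_⟩
  -- If the 4-cycle is not contained in one piece, then two opposite vertices lie in both pieces,
  -- so they are adjacent and form a triangle with a third vertex.
  have : (a ∈ A.verts ∧ b ∈ A.verts ∧ c ∈ A.verts ∧ d ∈ A.verts) ∨
      (a ∈ B.verts ∧ b ∈ B.verts ∧ c ∈ B.verts ∧ d ∈ B.verts) ∨
      (a ∈ A.verts ∧ a ∈ B.verts ∧ c ∈ A.verts ∧ c ∈ B.verts) ∨
      (b ∈ A.verts ∧ b ∈ B.verts ∧ d ∈ A.verts ∧ d ∈ B.verts) := by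
    have := side hab
    have := side hbc
    have := side hcd
    have := side hda
    tauto
  rcases this with ⟨ha, hb, hc, hd⟩ | ⟨ha, hb, hc, hd⟩ | ⟨h1, h2, h3, h4⟩ | ⟨h1, h2, h3, h4⟩
  · exact hA.2 a b c d (ofA ha hb hab) (ofA hb hc hbc) (ofA hc hd hcd) (ofA hd ha hda) hac hbd
  · exact hB.2 a b c d (ofB ha hb hab) (ofB hb hc hbc) (ofB hc hd hcd) (ofB hd ha hda) hac hbd
  · exact tri a b c hab hbc
      (SimpleGraph.Subgraph.sup_adj.2 (.inl (hAB a c h1 h2 h3 h4 hac).1)).symm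
  · exact tri b c d hbc hcd
      (SimpleGraph.Subgraph.sup_adj.2 (.inl (hAB b d h1 h2 h3 h4 hbd).1)).symm

theorem noShortCycle_of_isK2 {H : G.Subgraph} (h : IsK2 H) : NoShortCycle H := by
  obtain ⟨e⟩ := h
  have key : ∀ a b c, H.Adj a b → H.Adj b c → a = c := by
    intro a b c hab hbc
    have h1 : (⊤ : SimpleGraph (Fin 2)).Adj (e ⟨a, hab.fst_mem⟩) (e ⟨b, hab.snd_mem⟩) :=
      e.map_adj_iff.2 hab
    have h2 : (⊤ : SimpleGraph (Fin 2)).Adj (e ⟨b, hab.snd_mem⟩) (e ⟨c, hbc.snd_mem⟩) :=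
      e.map_adj_iff.2 hbc
    rw [SimpleGraph.top_adj] at h1 h2
    have h3 : e ⟨a, hab.fst_mem⟩ = e ⟨c, hbc.snd_mem⟩ := by omega
    simpa using e.injective h3
  exact ⟨fun a b c hab hbc hca => hca.ne (key a b c hab hbc).symm,
    fun a b c d hab hbc _ _ hac _ => hac (key a b c hab hbc)⟩

theorem cycleGraph_adj_val {n : ℕ} {a b : Fin n}
    (h : (SimpleGraph.cycleGraph n).Adj a b) :
    a.val = b.val + 1 ∨ b.val = a.val + 1 ∨ (a.val = 0 ∧ b.val + 1 = n) ∨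
      (b.val = 0 ∧ a.val + 1 = n) := by
  have key : ∀ x y : Fin n, (x - y).val = 1 →
      x.val = y.val + 1 ∨ (x.val = 0 ∧ y.val + 1 = n) := by
    intro x y h
    rcases le_or_gt y x with hxy | hxy
    · rw [Fin.coe_sub_iff_le.2 hxy] at h
      rw [Fin.le_def] at hxy
      omega
    · rw [Fin.coe_sub_iff_lt.2 hxy] at h
      rw [Fin.lt_def] at hxy
      omega
  rcases SimpleGraph.cycleGraph_adj'.1 h with h | h
  · rcases key a b h with h | h <;> tauto
  · rcases key b a h with h | h <;> tauto

theorem noShortCycle_of_isCycle {H : G.Subgraph} {n : ℕ} (hn : 5 ≤ n) (h : IsCycle H n) :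
    NoShortCycle H := by
  obtain ⟨-, ⟨e⟩⟩ := h
  have adj : ∀ {a b} (h : H.Adj a b), _ := fun {a b} h =>
    cycleGraph_adj_val (e.map_adj_iff.2
      (show H.coe.Adj ⟨a, h.fst_mem⟩ ⟨b, h.snd_mem⟩ from h))
  have ne : ∀ {a b} (ha : a ∈ H.verts) (hb : b ∈ H.verts), a ≠ b →
      (e ⟨a, ha⟩).val ≠ (e ⟨b, hb⟩).val := by
    intro a b ha hb hab h
    exact hab (by simpa using e.injective (Fin.ext h))
  constructor
  · intro a b c hab hbc hca
    have h1 := adj hab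
    have h2 := adj hbc
    have h3 := adj hca
    omega
  · intro a b c d hab hbc hcd hda hac hbd
    have h1 := adj hab
    have h2 := adj hbc
    have h3 := adj hcd
    have h4 := adj hda
    have h5 := ne hab.fst_mem hbc.snd_mem hac
    have h6 := ne hab.snd_mem hcd.snd_mem hbd
    omega

theorem noShortCycle_of_gluing {m : ℕ} {H : Fin (m + 1) → G.Subgraph}
    (hG : IsOuterplanarGluing G H) (hH : ∀ s, NoShortCycle (H s)) :
    NoShortCycle (⊤ : G.Subgraph) := by
  have key : ∀ n, n ≤ m → NoShortCycle (⨆ r : Fin (m + 1), ⨆ (_ : r.val ≤ n), H r) := by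
    intro n
    induction n with
    | zero =>
      intro _
      convert hH 0
      refine le_antisymm (iSup₂_le fun r hr => ?_) (le_iSup₂_of_le 0 (by simp) le_rfl)
      rw [show r = 0 from Fin.ext (by simpa using hr)]
    | succ n ih =>
      intro hn
      let s : Fin (m + 1) := ⟨n + 1, by omega⟩
      have hb : before H s = ⨆ r : Fin (m + 1), ⨆ (_ : r.val ≤ n), H r := by
        unfold before
        simp only [s, Fin.lt_def, Nat.lt_succ_iff]
      have hs : (⨆ r : Fin (m + 1), ⨆ (_ : r.val ≤ n + 1), H r) = before H s ⊔ H s := by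
        rw [hb]
        refine le_antisymm (iSup₂_le fun r hr => ?_) (sup_le (iSup₂_le fun r hr => ?_) ?_)
        · rcases Nat.le_succ_iff.1 hr with h | h
          · exact le_sup_of_le_left (le_iSup₂_of_le r h le_rfl)
          · rw [show r = s from Fin.ext h]
            exact le_sup_right
        · exact le_iSup₂_of_le r (by omega) le_rfl
        · exact le_iSup₂_of_le s le_rfl le_rfl
      rw [hs]
      refine noShortCycle_sup (hb ▸ ih (by omega)) (hH s) ?_
      intro a b ha ha' hb hb' hab
      rw [← SimpleGraph.Subgraph.inf_adj]
      have ha : a ∈ (before H s ⊓ H s).verts := ⟨ha, ha'⟩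
      have hb : b ∈ (before H s ⊓ H s).verts := ⟨hb, hb'⟩
      rcases hG.glue s (by simp [s, Fin.ext_iff]) with ⟨v, h⟩ | ⟨u, v, huv, h, -⟩
      · rw [h] at ha hb
        simp only [SimpleGraph.singletonSubgraph_verts, Set.mem_singleton_iff] at ha hb
        exact absurd (ha.trans hb.symm) hab
      · rw [h] at ha hb ⊢
        simp only [SimpleGraph.subgraphOfAdj_verts, Set.mem_insert_iff,
          Set.mem_singleton_iff] at ha hb
        rcases ha with rfl | rfl <;> rcases hb with rfl | rfl <;> simp_all [Sym2.eq_swap]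
  have h := key m le_rfl
  have : (⨆ r : Fin (m + 1), ⨆ (_ : r.val ≤ m), H r) = ⊤ := by
    rw [← hG.union]
    refine iSup_congr fun r => ?_
    rw [iSup_pos (Nat.lt_succ_iff.1 r.2)]
  rwa [this] at h

theorem finite_of_gluing {m : ℕ} {H : Fin (m + 1) → G.Subgraph}
    (hG : IsOuterplanarGluing G H) : Finite V := by
  have h : (Set.univ : Set V) = ⋃ s, (H s).verts := by
    rw [← SimpleGraph.Subgraph.verts_iSup, hG.union, SimpleGraph.Subgraph.verts_top]
  rw [← Set.finite_univ_iff, h]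
  refine Set.finite_iUnion fun s => ?_
  rcases hG.component s with ⟨⟨e⟩⟩ | ⟨n, -, ⟨e⟩⟩
  · exact Set.finite_coe_iff.1 (Finite.of_equiv _ e.toEquiv.symm)
  · exact Set.finite_coe_iff.1 (Finite.of_equiv _ e.toEquiv.symm)

end Outerplanar

/-! ### The diagonal of magnitude homology -/

namespace MagnitudeHomology

variable {V : Type u} (G : SimpleGraph V)

theorem le_tupleLength {k : ℕ} {x : Fin (k + 1) → V} (hx : ∀ i : Fin k, x i.castSucc ≠ x i.succ) :
    (k : ℕ∞) ≤ tupleLength G x := by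
  calc (k : ℕ∞) = ∑ _i : Fin k, (1 : ℕ∞) := by simp
    _ ≤ _ := Finset.sum_le_sum fun i _ =>
      Order.one_le_iff_pos.2 (SimpleGraph.edist_pos_of_ne (hx i))

theorem isEmpty_path_of_lt {k l : ℕ} (h : l < k) :
    IsEmpty {x : Fin (k + 1) → V // IsPathOfLength G l x} := by
  refine ⟨fun x => ?_⟩
  have := le_tupleLength G x.2.1
  rw [x.2.2] at this
  exact absurd (by exact_mod_cast this) (not_le.2 h)

theorem boundaries_diagonal (k : ℕ) : boundaries G k k = ⊥ := by
  have := isEmpty_path_of_lt G (Nat.lt_succ_self k)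
  rw [boundaries, LinearMap.range_eq_bot]
  exact Subsingleton.elim _ _

/-- On the diagonal, homology classes are the same as cycles. -/
noncomputable def diagonalEquiv (k : ℕ) : MH G k k ≃ₗ[ℤ] cycles G k k :=
  Submodule.quotEquivOfEqBot _ (by
    rw [boundaries_diagonal, Submodule.submoduleOf, Submodule.comap_bot, Submodule.ker_subtype])

theorem isPathOfLength_diagonal_iff {k : ℕ} {x : Fin (k + 1) → V} :
    IsPathOfLength G k x ↔ ∀ i : Fin k, G.Adj (x i.castSucc) (x i.succ) := by
  constructor
  · rintro ⟨hne, hlen⟩ i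
    have hpos : ∀ j ∈ Finset.univ, (1 : ℕ∞) ≤ G.edist (x (Fin.castSucc j)) (x j.succ) := fun j _ =>
      Order.one_le_iff_pos.2 (SimpleGraph.edist_pos_of_ne (hne j))
    rw [← SimpleGraph.edist_eq_one_iff_adj]
    refine le_antisymm ?_ (hpos i (Finset.mem_univ i))
    have h1 : ∑ j ∈ Finset.univ.erase i, (1 : ℕ∞) ≤
        ∑ j ∈ Finset.univ.erase i, G.edist (x (Fin.castSucc j)) (x j.succ) :=
      Finset.sum_le_sum fun j _ => hpos j (Finset.mem_univ j)
    have h2 := Finset.add_sum_erase Finset.univ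
      (fun j : Fin k => G.edist (x (Fin.castSucc j)) (x j.succ)) (Finset.mem_univ i)
    have h3 := Finset.add_sum_erase Finset.univ (fun _ : Fin k => (1 : ℕ∞)) (Finset.mem_univ i)
    have hne_top : ∑ j ∈ Finset.univ.erase i, (1 : ℕ∞) ≠ ⊤ := by simp
    refine (ENat.add_le_add_iff_right hne_top).1 ?_
    calc _ ≤ _ := add_le_add_right h1 _
      _ = (k : ℕ∞) := by rw [h2]; exact hlen
      _ = _ := by rw [h3]; simp
  · intro h
    refine ⟨fun i => (h i).ne, ?_⟩
    simp [tupleLength, SimpleGraph.edist_eq_one_iff_adj.2 (h _)]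

theorem gen_apply {k l : ℕ} (x : Fin (k + 1) → V)
    (y : {x : Fin (k + 1) → V // IsPathOfLength G l x}) [Decidable (x = y.1)] :
    gen G l x y = if x = y.1 then 1 else 0 := by
  classical
  unfold gen
  by_cases h : x = y.1
  · rw [dif_pos (h ▸ y.2), if_pos h, Finsupp.single_apply, if_pos (Subtype.ext h)]
  · rw [if_neg h]
    split_ifs with hx
    · rw [Finsupp.single_apply, if_neg fun h' => h (congrArg Subtype.val h')]
    · rfl

theorem eraseInner_castSucc {k : ℕ} (x : Fin (k + 2) → V) (i : Fin k) :
    eraseInner x i i.castSucc = x i.castSucc.castSucc := by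
  unfold eraseInner
  congr 1
  ext
  simp [Fin.succAbove]

theorem eraseInner_succ {k : ℕ} (x : Fin (k + 2) → V) (i : Fin k) :
    eraseInner x i i.succ = x i.succ.succ := by
  unfold eraseInner
  congr 1
  ext
  simp [Fin.succAbove]

/-- Away from position `i`, the consecutive pairs of `eraseInner x i` are consecutive in `x`. -/
theorem exists_eraseInner_eq {k : ℕ} (x : Fin (k + 2) → V) {i m : Fin k} (h : m ≠ i) :
    ∃ j : Fin (k + 1), eraseInner x i m.castSucc = x j.castSucc ∧
      eraseInner x i m.succ = x j.succ := by
  refine ⟨i.succ.succAbove m, ?_, ?_⟩ <;>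
  · unfold eraseInner
    congr 1
    rcases i with ⟨i, _⟩
    rcases m with ⟨m, _⟩
    simp only [ne_eq, Fin.mk.injEq] at h
    simp only [Fin.succAbove, Fin.ext_iff, Fin.lt_def, Fin.val_castSucc, Fin.val_succ]
    split_ifs <;> simp at * <;> omega

/-- Deleting an inner vertex of a walk preserves its length if and only if the two neighbouring
vertices are at distance two. -/
theorem isPathOfLength_eraseInner_iff {k : ℕ} {x : Fin (k + 2) → V}
    (hx : IsPathOfLength G (k + 1) x) (i : Fin k) :
    IsPathOfLength G (k + 1) (eraseInner x i) ↔
      G.edist (x i.castSucc.castSucc) (x i.succ.succ) = 2 := by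
  have hadj := (isPathOfLength_diagonal_iff G).1 hx
  have h := tupleLength_eraseInner G x i
  rw [SimpleGraph.edist_eq_one_iff_adj.2 (hadj i.castSucc), Fin.succ_castSucc,
    SimpleGraph.edist_eq_one_iff_adj.2 (hadj i.succ), hx.2, one_add_one_eq_two] at h
  have htop : ((k + 1 : ℕ) : ℕ∞) ≠ ⊤ := ENat.natCast_ne_top _
  constructor
  · intro hp
    rw [hp.2] at h
    exact ((ENat.add_right_injective_of_ne_top htop) h).symm
  · intro h2
    rw [h2] at h
    exact isPathOfLength_eraseInner G x hx i ((ENat.add_left_injective_of_ne_top (by simp)) h)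

variable {G}

/-- A face of a walk determines the walk and the deleted position, if midpoints of pairs of vertices
at distance two are unique. -/
theorem eraseInner_injective
    (hmid : ∀ a b c d, G.Adj a b → G.Adj b c → G.Adj c d → G.Adj d a → a ≠ c → b ≠ d → False)
    {k : ℕ} {x z : Fin (k + 2) → V}
    (hx : IsPathOfLength G (k + 1) x) (hz : IsPathOfLength G (k + 1) z) {i j : Fin k}
    (h : eraseInner z j = eraseInner x i) (hp : IsPathOfLength G (k + 1) (eraseInner x i)) :
    j = i ∧ z = x := by
  have hxa := (isPathOfLength_diagonal_iff G).1 hx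
  have hza := (isPathOfLength_diagonal_iff G).1 hz
  have hx2 := (isPathOfLength_eraseInner_iff G hx i).1 hp
  have hz2 := (isPathOfLength_eraseInner_iff G hz j).1 (h ▸ hp)
  -- The position of the deleted vertex is that of the only step of length two.
  have hji : j = i := by
    by_contra hne
    obtain ⟨m, h1, h2⟩ := exists_eraseInner_eq x hne
    rw [← h, eraseInner_castSucc] at h1
    rw [← h, eraseInner_succ] at h2
    rw [h1, h2, SimpleGraph.edist_eq_one_iff_adj.2 (hxa m)] at hz2
    exact absurd hz2 (by norm_num)
  subst hji
  refine ⟨rfl, ?_⟩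
  have hoff : ∀ m, z (j.castSucc.succ.succAbove m) = x (j.castSucc.succ.succAbove m) :=
    fun m => congrFun h m
  have h1 : z j.castSucc.castSucc = x j.castSucc.castSucc := by
    rw [← eraseInner_castSucc z, h, eraseInner_castSucc]
  have h2 : z j.succ.succ = x j.succ.succ := by
    rw [← eraseInner_succ z, h, eraseInner_succ]
  funext p
  rcases Fin.eq_self_or_eq_succAbove j.castSucc.succ p with rfl | ⟨m, rfl⟩
  · by_contra hne
    have e1 := hxa j.castSucc
    have e2 := hxa j.succ
    have e3 := hza j.castSucc
    have e4 := hza j.succ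
    rw [← Fin.succ_castSucc] at e2 e4
    rw [h1] at e3
    rw [h2] at e4
    refine hmid _ _ _ _ e1 e2 e4.symm e3.symm ?_ (Ne.symm hne)
    intro h0
    rw [h0, SimpleGraph.edist_self] at hx2
    exact absurd hx2 (by norm_num)
  · exact hoff m

/-- The walks `(u,v,u,v,…)` of length `k + 1`. -/
def alternating (G : SimpleGraph V) (k : ℕ) :
    Set {x : Fin (k + 1 + 1) → V // IsPathOfLength G (k + 1) x} :=
  {x | ∀ i : Fin k, x.1 i.castSucc.castSucc = x.1 i.succ.succ}

/-- In a graph without triangles and 4-cycles, the diagonal cycles are exactly the combinations of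
alternating walks. -/
theorem ker_boundary_eq_supported
    (htri : ∀ a b c, G.Adj a b → G.Adj b c → G.Adj c a → False)
    (hmid : ∀ a b c d, G.Adj a b → G.Adj b c → G.Adj c d → G.Adj d a → a ≠ c → b ≠ d → False)
    (k : ℕ) :
    LinearMap.ker (boundary G k (k + 1)) = Finsupp.supported ℤ ℤ (alternating G k) := by
  classical
  apply le_antisymm
  · intro f hf
    rw [Finsupp.mem_supported]
    intro x hxf
    by_contra hx
    obtain ⟨i, hi⟩ : ∃ i : Fin k, x.1 i.castSucc.castSucc ≠ x.1 i.succ.succ := by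
      simpa [alternating] using hx
    have hadj := (isPathOfLength_diagonal_iff G).1 x.2
    have h1 := hadj i.castSucc
    have h2 := hadj i.succ
    rw [← Fin.succ_castSucc] at h2
    have hp : IsPathOfLength G (k + 1) (eraseInner x.1 i) := by
      rw [isPathOfLength_eraseInner_iff G x.2]
      refine le_antisymm ?_ ?_
      · refine (G.edist_triangle (v := x.1 i.castSucc.succ)).trans ?_
        rw [SimpleGraph.edist_eq_one_iff_adj.2 h1, SimpleGraph.edist_eq_one_iff_adj.2 h2,
          one_add_one_eq_two]
      · have hpos := SimpleGraph.edist_pos_of_ne (G := G) hi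
        have hne1 : G.edist (x.1 i.castSucc.castSucc) (x.1 i.succ.succ) ≠ 1 := fun h =>
          htri _ _ _ h1 h2 (SimpleGraph.edist_eq_one_iff_adj.1 h).symm
        rw [← one_add_one_eq_two]
        exact Order.add_one_le_of_lt (lt_of_le_of_ne (Order.one_le_iff_pos.2 hpos) hne1.symm)
    -- The coefficient of the face `eraseInner x i` in `∂ f` is `± f x`.
    have hcoef : boundary G k (k + 1) f ⟨_, hp⟩ = f x * (-1) ^ ((i : ℕ) + 1) := by
      rw [boundary, Finsupp.linearCombination_apply, Finsupp.sum, Finsupp.finsetSum_apply,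
        Finset.sum_eq_single x]
      · rw [Finsupp.smul_apply, Finsupp.finsetSum_apply, Finset.sum_eq_single i]
        · simp [gen_apply]
        · intro j _ hj
          rw [Finsupp.smul_apply, gen_apply, if_neg, smul_zero]
          exact fun h => hj (eraseInner_injective hmid x.2 x.2 h hp).1
        · simp
      · intro z _ hz
        rw [Finsupp.smul_apply, Finsupp.finsetSum_apply, Finset.sum_eq_zero, smul_zero]
        intro j _
        rw [Finsupp.smul_apply, gen_apply, if_neg, smul_zero]
        exact fun h => hz (Subtype.ext (eraseInner_injective hmid x.2 z.2 h hp).2)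
      · exact fun h => absurd hxf h
    rw [LinearMap.mem_ker.1 hf, Finsupp.zero_apply, eq_comm, mul_eq_zero] at hcoef
    rcases hcoef with h | h
    · exact Finsupp.mem_support_iff.1 hxf h
    · exact absurd h (by simp)
  · rw [Finsupp.supported_eq_span_single, Submodule.span_le]
    rintro _ ⟨x, hx, rfl⟩
    rw [SetLike.mem_coe, LinearMap.mem_ker]
    rw [show x = ⟨x.1, x.2⟩ from rfl, boundary_single]
    refine Finset.sum_eq_zero fun i _ => ?_
    rw [gen, dif_neg, smul_zero]
    intro hp
    rw [isPathOfLength_eraseInner_iff G x.2, hx i, SimpleGraph.edist_self] at hp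
    exact absurd hp (by norm_num)

/-- An alternating walk is determined by its first step, which can be any oriented edge. -/
noncomputable def alternatingEquivDart (G : SimpleGraph V) (k : ℕ) : alternating G k ≃ G.Dart :=
  Equiv.ofBijective
    (fun x => ⟨(x.1.1 0, x.1.1 1), (isPathOfLength_diagonal_iff G).1 x.1.2 0⟩) (by
    constructor
    · rintro ⟨⟨x, hx⟩, hx'⟩ ⟨⟨y, hy⟩, hy'⟩ h
      replace h := Prod.mk.inj (congrArg SimpleGraph.Dart.toProd h)
      have key : ∀ n (hn : n + 1 < k + 1 + 1),
          x ⟨n, by omega⟩ = y ⟨n, by omega⟩ ∧ x ⟨n + 1, hn⟩ = y ⟨n + 1, hn⟩ := by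
        intro n
        induction n with
        | zero => exact fun _ => h
        | succ n ih =>
          intro hn
          obtain ⟨h1, h2⟩ := ih (by omega)
          refine ⟨h2, ?_⟩
          exact ((hx' ⟨n, by omega⟩).symm.trans h1).trans (hy' ⟨n, by omega⟩)
      refine Subtype.ext (Subtype.ext (funext fun ⟨p, hp⟩ => ?_))
      cases p with
      | zero => exact h.1
      | succ p => exact (key p hp).2
    · rintro ⟨⟨a, b⟩, hab⟩
      refine ⟨⟨⟨fun p => if Even p.val then a else b, ?_⟩, ?_⟩, ?_⟩
      · rw [isPathOfLength_diagonal_iff]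
        intro i
        by_cases hi : Even i.val
        · simpa [hi, Nat.even_add_one] using hab
        · simpa [hi, Nat.even_add_one] using hab.symm
      · intro i
        simp [Nat.even_add_one]
      · simp)

/-- A tuple with a single entry is a path of length zero. -/
def pathZeroEquiv (G : SimpleGraph V) : {x : Fin (0 + 1) → V // IsPathOfLength G 0 x} ≃ V where
  toFun x := x.1 0
  invFun v := ⟨fun _ => v, fun i => i.elim0, by simp [tupleLength]⟩
  left_inv x := Subtype.ext (funext fun i => congrArg x.1 (Subsingleton.elim (α := Fin 1) _ _))
  right_inv _ := rfl

theorem natCard_dart (G : SimpleGraph V) [Finite V] : Nat.card G.Dart = 2 * G.edgeSet.ncard := by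
  classical
  have := Fintype.ofFinite V
  rw [Nat.card_eq_fintype_card, SimpleGraph.dart_card_eq_twice_card_edges,
    ← SimpleGraph.coe_edgeFinset, Set.ncard_coe_finset]

end MagnitudeHomology

/-! ### Torsion-freeness and ranks -/

theorem theorem4p4 {V : Type*} (G : SimpleGraph V) {m : ℕ} (H : Fin (m + 1) → G.Subgraph)
    (hG : Outerplanar.IsOuterplanarGluing G H)
    (hH : ∀ s, Outerplanar.IsK2 (H s) ∨
      ∃ n, Even n ∧ n ≠ 4 ∧ Outerplanar.IsCycle (H s) n) :
    (∀ k : ℕ, Module.IsTorsionFree ℤ (MagnitudeHomology.MH G k k)) ∧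
    Module.rank ℤ (MagnitudeHomology.MH G 0 0) = (Nat.card V : Cardinal) ∧
    ∀ k : ℕ, 0 < k →
      Module.rank ℤ (MagnitudeHomology.MH G k k) = ((2 * G.edgeSet.ncard : ℕ) : Cardinal) := by
  have hfin : Finite V := Outerplanar.finite_of_gluing hG
  have hcyc : Outerplanar.NoShortCycle (⊤ : G.Subgraph) :=
    Outerplanar.noShortCycle_of_gluing hG fun s => by
      rcases hH s with h | ⟨n, hn, hn4, h⟩
      · exact Outerplanar.noShortCycle_of_isK2 h
      · have := h.1
        obtain ⟨r, rfl⟩ := hn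
        exact Outerplanar.noShortCycle_of_isCycle (by omega) h
  simp only [Outerplanar.NoShortCycle, SimpleGraph.Subgraph.top_adj] at hcyc
  refine ⟨fun k => ?_, ?_, fun k hk => ?_⟩
  · exact (MagnitudeHomology.diagonalEquiv G k).injective.moduleIsTorsionFree _ (by simp)
  · rw [(MagnitudeHomology.diagonalEquiv G 0).rank_eq]
    change Module.rank ℤ (⊤ : Submodule ℤ (MagnitudeHomology.MC G 0 0)) = _
    rw [rank_top, rank_finsupp_self, Cardinal.lift_uzero,
      Cardinal.mk_congr (MagnitudeHomology.pathZeroEquiv G), Nat.cast_card]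
  · obtain ⟨k, rfl⟩ : ∃ j, k = j + 1 := ⟨k - 1, by omega⟩
    rw [(MagnitudeHomology.diagonalEquiv G (k + 1)).rank_eq]
    change Module.rank ℤ (LinearMap.ker (MagnitudeHomology.boundary G k (k + 1))) = _
    have : Finite G.Dart := Finite.of_injective _ SimpleGraph.Dart.toProd_injective
    rw [MagnitudeHomology.ker_boundary_eq_supported hcyc.1 hcyc.2,
      (Finsupp.supportedEquivFinsupp _).rank_eq, rank_finsupp_self, Cardinal.lift_uzero,
      Cardinal.mk_congr (MagnitudeHomology.alternatingEquivDart G k),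
      ← MagnitudeHomology.natCard_dart, Nat.cast_card]
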